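/- Let $(X,\nu)$ be a standard Borel space with a finite non-negative non-atomic measure $\nu$. Let $D^+$ be the cone of all finite positive discrete measures $\eta=\sum_i z_i\delta_{x_i}$ on $X$ (at most countably many points $x_i\in X$, $z_i>0$, $\sum_i z_i<\infty$), with the $\sigma$-algebra generated by the maps $\eta\mapsto\eta(A)$, $A\subset X$ Borel. Let $P_\Gamma$ be the gamma measure on $D^+$, that is, the law of the Lévy process on $(X,\nu)$ with Lévy measure $d\Lambda(z)=z^{-1}e^{-z}\,dz$, $z>0$: the probability measure on $D^+$ such that $$\int_{D^+}\exp\Big(-\int_X b\,d\eta\Big)\,dP_\Gamma(\eta)=\exp\Big(\int_X\log\psi(b(x))\,d\nu(x)\Big),\qquad \psi(t)=\exp\Big(-\int_0^\infty(1-e^{-ts})\,s^{-1}e^{-s}\,ds\Big)=\frac1{1+t},$$ for every bounded non-negative Borel function $b$ on $X$. Theorem 3. Let $a:X\to[0,\infty)$ be a measurable function with $\int_X|\log a|\,d\nu<\infty$, where $\log 0=-\infty$ (so $a>0$ $\nu$-almost everywhere). Then for $P_\Gamma$-almost every $\eta=\sum_i z_i\delta_{x_i}$ the integrals $\int_X a\,d\eta$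 and $\int_X\big|\frac1a-1\big|\,d\eta$ are finite, so that the multiplicator $M_a\eta=a\eta=\sum_i a(x_i)z_i\delta_{x_i}$ is a $P_\Gamma$-almost everywhere defined measurable map $D^+\to D^+$. The measure $P_\Gamma$ is quasi-invariant under $M_a$, that is, the image measure $M_aP_\Gamma$ and $P_\Gamma$ are mutually absolutely continuous, and for $P_\Gamma$-almost every $\eta$ $$\frac{d(M_aP_\Gamma)}{dP_\Gamma}(\eta)=\exp\Big(-\int_X\log a(x)\,d\nu(x)\Big)\cdot\exp\Big(-\int_X\Big(\frac1{a(x)}-1\Big)d\eta(x)\Big).$$ -/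

import Mathlib

open MeasureTheory
open scoped ENNReal NNReal

namespace GammaProcess

variable {X : Type*} [MeasurableSpace X]

/-- Finite positive discrete measures `∑ z_i δ_{x_i}`: countably many distinct atoms `x_i`, with
masses `z_i > 0` and `∑ z_i < ∞` (the empty sum, that is the zero measure, is included). -/
def IsFiniteDiscrete (η : Measure X) : Prop :=
  ∃ (S : Set X) (z : S → ℝ≥0), S.Countable ∧ (∀ x, 0 < z x) ∧ Summable z ∧
    η = Measure.sum fun x : S => (z x : ℝ≥0∞) • Measure.dirac (x : X)

theorem isFiniteDiscrete_zero : IsFiniteDiscrete (0 : Measure X) := by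
  refine ⟨∅, fun _ => 1, Set.countable_empty, fun _ => one_pos, ?_, ?_⟩
  · exact (hasSum_empty).summable
  · ext s hs
    simp

/-- The integral of an arbitrary function over a measurable set against a sum of point masses. -/
theorem setLIntegral_sum_dirac [MeasurableSingletonClass X] (S : Set X) (z : S → ℝ≥0)
    (f : X → ℝ≥0∞) {A : Set X} (hA : MeasurableSet A) :
    ∫⁻ x in A, f x ∂(Measure.sum fun x : S => (z x : ℝ≥0∞) • Measure.dirac (x : X)) =
      ∑' x : S, (z x : ℝ≥0∞) * A.indicator f x := by
  rw [← lintegral_indicator hA, lintegral_sum_measure]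
  refine tsum_congr fun x => ?_
  rw [lintegral_smul_measure, lintegral_dirac, smul_eq_mul]

/-- If `∫ a dη < ∞`, then `a η` is again a finite positive discrete measure. -/
theorem IsFiniteDiscrete.withDensity [MeasurableSingletonClass X] {η : Measure X}
    (hη : IsFiniteDiscrete η) (a : X → ℝ≥0) (ha : ∫⁻ x, a x ∂η ≠ ∞) :
    IsFiniteDiscrete (η.withDensity fun x => (a x : ℝ≥0∞)) := by
  obtain ⟨S, z, hS, hz, -, rfl⟩ := hη
  let T : Set X := {x | x ∈ S ∧ a x ≠ 0}
  have hTS : T ⊆ S := fun x hx => hx.1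
  have hinj : Function.Injective (Set.inclusion hTS) := Set.inclusion_injective hTS
  have key : ∀ A : Set X, MeasurableSet A →
      ∫⁻ x in A, (a x : ℝ≥0∞) ∂(Measure.sum fun x : S => (z x : ℝ≥0∞) • Measure.dirac (x : X)) =
      ∑' x : T, ((a x * z (Set.inclusion hTS x) : ℝ≥0) : ℝ≥0∞) *
        A.indicator (1 : X → ℝ≥0∞) x := by
    intro A hA
    rw [setLIntegral_sum_dirac S z _ hA, ← hinj.tsum_eq]
    · refine tsum_congr fun x => ?_
      by_cases hx : (x : X) ∈ A <;> simp [hx, mul_comm]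
    · intro x hx
      refine ⟨⟨x, x.2, fun h => hx ?_⟩, rfl⟩
      by_cases hxA : (x : X) ∈ A <;> simp [hxA, h]
  refine ⟨T, fun x => a x * z (Set.inclusion hTS x), hS.mono hTS, fun x => ?_, ?_, ?_⟩
  · exact mul_pos (pos_iff_ne_zero.2 x.2.2) (hz _)
  · have h := key Set.univ MeasurableSet.univ
    rw [Measure.restrict_univ] at h
    rw [h] at ha
    rw [← ENNReal.tsum_coe_ne_top_iff_summable]
    simpa using ha
  · ext A hA
    rw [withDensity_apply _ hA, key A hA, Measure.sum_apply _ hA]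
    refine tsum_congr fun x => ?_
    rw [Measure.smul_apply, Measure.dirac_apply' _ hA, smul_eq_mul]

variable (X) in
/-- The cone `D⁺` of all finite positive discrete measures on `X`, with the `σ`-algebra generated
by the evaluations `η ↦ η A`, `A` measurable. -/
abbrev DiscreteCone : Type _ := {η : Measure X // IsFiniteDiscrete η}

/-- `ψ_Λ`, the Laplace transform of the infinitely divisible law with Lévy measure `Λ`. -/
noncomputable def levyLaplace (Λ : Measure ℝ) (t : ℝ) : ℝ :=
  Real.exp (-∫ s in Set.Ioi (0 : ℝ), (1 - Real.exp (-(t * s))) ∂Λ)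

/-- `P` is the law of the homogeneous Lévy process on `(X, ν)` with Lévy measure `Λ`: the
probability measure on the cone with Laplace functional
`E exp (-∫ b dη) = exp (∫ log ψ_Λ(b(x)) dν(x))` for all bounded non-negative Borel `b`. -/
structure IsLevyLaw (ν : Measure X) (Λ : Measure ℝ) (P : Measure (DiscreteCone X)) : Prop where
  isProbabilityMeasure : IsProbabilityMeasure P
  laplace : ∀ b : X → ℝ, Measurable b → (∀ x, 0 ≤ b x) → (∃ C, ∀ x, b x ≤ C) →
    ∫ η, Real.exp (-∫ x, b x ∂(η : Measure X)) ∂P =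
      Real.exp (∫ x, Real.log (levyLaplace Λ (b x)) ∂ν)

/-- The Lévy measure `z⁻¹ e^{-z} dz`, `z > 0`, of the gamma process. -/
noncomputable def gammaLevyMeasure : Measure ℝ :=
  (volume.restrict (Set.Ioi (0 : ℝ))).withDensity fun z => ENNReal.ofReal (z⁻¹ * Real.exp (-z))

/-- `P` is the gamma measure `P_Γ(ν)`, the law of the gamma process on `(X, ν)`. -/
def IsGammaMeasure (ν : Measure X) (P : Measure (DiscreteCone X)) : Prop :=
  IsLevyLaw ν gammaLevyMeasure P

/-- The class of non-negative functions with `ν`-summable logarithm. As `log 0 = -∞`,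
summability includes that `a` vanishes only on a `ν`-null set (whereas `Real.log 0 = 0`). -/
structure HasSummableLog (ν : Measure X) (a : X → ℝ≥0) : Prop where
  aemeasurable : AEMeasurable a ν
  ae_pos : ∀ᵐ x ∂ν, 0 < a x
  integrable_log : Integrable (fun x => Real.log (a x)) ν

open Classical in
/-- The multiplicator `M_a η = a η`, that is `∑ z_i δ_{x_i} ↦ ∑ a(x_i) z_i δ_{x_i}`. Where `a η` is
not a finite measure, the value is set to be the zero measure. -/
noncomputable def multiplicator [MeasurableSingletonClass X] (a : X → ℝ≥0)
    (η : DiscreteCone X) : DiscreteCone X :=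
  if h : ∫⁻ x, a x ∂(η : Measure X) ≠ ∞ then
    ⟨(η : Measure X).withDensity fun x => (a x : ℝ≥0∞), η.2.withDensity a h⟩
  else ⟨0, isFiniteDiscrete_zero⟩

/-- The density
`η ↦ exp (-∫ log a dν) * exp (-∫ (1/a - 1) dη)`. -/
noncomputable def multiplicatorDensity (ν : Measure X) (a : X → ℝ≥0) (η : DiscreteCone X) : ℝ :=
  Real.exp (-∫ x, Real.log (a x) ∂ν) *
    Real.exp (-∫ x, (1 / (a x : ℝ) - 1) ∂(η : Measure X))

end GammaProcess

namespace GammaProcess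

/-! ### The gamma Laplace transform and `exp (-y)` on `[0, ∞]`. -/

open Filter Topology

variable {X : Type*} [MeasurableSpace X]

/-! Frullani's integral turns the defining property of `P` into `E exp (-∫ f dη) = exp (-∫ log (1 +
f) dν)`, and a finite measure on the cone is determined by its Laplace functional
(`ext_of_laplace`). So it suffices to compare the functionals of the two sides at bounded `b ≥ 0`.
For the image law, `b` is replaced by `a b`, giving `exp (-∫ log (1 + a b) dν)`. For the law with
the claimed density, one needs the functional at `g = 1/a - 1 + b`, and `1 + g = (1 + a b) / a`
gives the same value.

The difficulty is that `g` is negative where `a` is large, while the functional is known only on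
non-negative functions. If `a ≤ 1` then `g ≥ 0`, and the density formula follows
(`hasMultiplicatorDensity_of_le_one`). This special case, used as a change of variable with `c = min
1 (1 + g)`, extends the functional to all `g > -1` with `log (1 + g)` integrable (`laplaceAt`), and
the general density formula follows by the same comparison. -/

/-- The Laplace transform of the gamma law, by Frullani's integral. -/
theorem levyLaplace_gammaLevyMeasure {t : ℝ} (ht : 0 ≤ t) :
    levyLaplace gammaLevyMeasure t = (1 + t)⁻¹ := by
  have hmeas : Measurable fun z : ℝ => (z⁻¹ * Real.exp (-z)).toNNReal := by fun_prop
  have hint : IntegrableOn (fun x : ℝ => x⁻¹ • (Real.exp (-(1 * x)) - Real.exp (-((1 + t) * x))))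
      (Set.Ioi 0) := by
    -- The bound `1 - exp (-t x) ≤ t x` cancels the singularity of `x⁻¹` at zero.
    have hdom : IntegrableOn (fun x : ℝ => t * Real.exp (-x)) (Set.Ioi 0) :=
      (integrableOn_exp_neg_Ioi 0).const_mul t
    refine Integrable.mono' hdom (by fun_prop) ?_
    filter_upwards [ae_restrict_mem measurableSet_Ioi] with x hx
    have hx : 0 < x := hx
    have h1 : Real.exp (-(1 * x)) - Real.exp (-((1 + t) * x)) =
        Real.exp (-x) * (1 - Real.exp (-(t * x))) := by
      rw [mul_sub, ← Real.exp_add]; ring_nf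
    have h2 : 1 - Real.exp (-(t * x)) ≤ t * x := by linarith [Real.add_one_le_exp (-(t * x))]
    have h3 : 0 ≤ 1 - Real.exp (-(t * x)) := by
      rw [sub_nonneg, Real.exp_le_one_iff]; nlinarith
    rw [smul_eq_mul, h1, Real.norm_of_nonneg (by positivity)]
    calc x⁻¹ * (Real.exp (-x) * (1 - Real.exp (-(t * x))))
        ≤ x⁻¹ * (Real.exp (-x) * (t * x)) := by gcongr
      _ = t * Real.exp (-x) := by field_simp
  have hfr := Frullani.integral_Ioi_eq (f := fun x : ℝ => Real.exp (-x)) (L := 1) (R := 0)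
    (a := 1) (b := 1 + t)
    ((Continuous.locallyIntegrable (by fun_prop)).locallyIntegrableOn _) one_pos (by linarith)
    (by
      have : Continuous fun x : ℝ => Real.exp (-x) := by fun_prop
      simpa using (this.tendsto 0).mono_left nhdsWithin_le_nhds)
    (Real.tendsto_exp_atBot.comp tendsto_neg_atTop_atBot) hint
  have hkey : ∫ s in Set.Ioi (0 : ℝ), (1 - Real.exp (-(t * s))) ∂gammaLevyMeasure =
      Real.log (1 + t) := by
    have : gammaLevyMeasure.restrict (Set.Ioi 0) = (volume.restrict (Set.Ioi (0 : ℝ))).withDensity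
        fun z => ((z⁻¹ * Real.exp (-z)).toNNReal : ℝ≥0∞) := by
      rw [gammaLevyMeasure, restrict_withDensity measurableSet_Ioi,
        Measure.restrict_restrict measurableSet_Ioi, Set.inter_self]
      rfl
    rw [this, integral_withDensity_eq_integral_smul hmeas]
    simp only [div_one, sub_zero, smul_eq_mul, mul_one] at hfr
    rw [← hfr]
    refine setIntegral_congr_fun measurableSet_Ioi fun x hx => ?_
    have hx : 0 < x := hx
    simp only [NNReal.smul_def, smul_eq_mul]
    rw [Real.coe_toNNReal _ (by positivity), mul_assoc, mul_sub, ← Real.exp_add]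
    ring_nf
  rw [levyLaplace, hkey, Real.exp_neg, Real.exp_log (by linarith)]

theorem IsFiniteDiscrete.isFiniteMeasure {η : Measure X} (hη : IsFiniteDiscrete η) :
    IsFiniteMeasure η := by
  obtain ⟨S, z, -, -, hz, rfl⟩ := hη
  refine ⟨?_⟩
  rw [Measure.sum_apply _ MeasurableSet.univ]
  simpa using (ENNReal.tsum_coe_ne_top_iff_summable.2 hz).lt_top

instance (η : DiscreteCone X) : IsFiniteMeasure (η : Measure X) := η.2.isFiniteMeasure

/-- The function `y ↦ exp (-y)` on `[0, ∞]`. -/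
noncomputable def expNeg (y : ℝ≥0∞) : ℝ≥0∞ := EReal.exp (-(y : EReal))

@[simp] theorem expNeg_zero : expNeg 0 = 1 := by simp [expNeg]

@[simp] theorem expNeg_top : expNeg ∞ = 0 := by simp [expNeg]

theorem expNeg_ofReal {x : ℝ} (hx : 0 ≤ x) :
    expNeg (ENNReal.ofReal x) = ENNReal.ofReal (Real.exp (-x)) := by
  rw [expNeg, EReal.coe_ennreal_ofReal, max_eq_left hx, ← EReal.coe_neg, EReal.exp_coe]

theorem continuous_expNeg : Continuous expNeg :=
  ENNReal.continuous_exp.comp (continuous_neg.comp continuous_coe_ennreal_ereal)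

theorem antitone_expNeg : Antitone expNeg := fun _ _ h =>
  EReal.exp_monotone (EReal.neg_le_neg_iff.2 (EReal.coe_ennreal_le_coe_ennreal_iff.2 h))

theorem expNeg_le_one (y : ℝ≥0∞) : expNeg y ≤ 1 := by
  simpa using antitone_expNeg (zero_le (a := y))

theorem expNeg_ne_top (y : ℝ≥0∞) : expNeg y ≠ ∞ :=
  ((expNeg_le_one y).trans_lt ENNReal.one_lt_top).ne

theorem measurable_lintegral_discreteCone {f : X → ℝ≥0∞} (hf : Measurable f) :
    Measurable fun η : DiscreteCone X => ∫⁻ x, f x ∂(η : Measure X) :=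
  (Measure.measurable_lintegral hf).comp measurable_subtype_coe

theorem expNeg_lintegral_coe {μ : Measure X} {f : X → ℝ≥0}
    (hf : Integrable (fun x => (f x : ℝ)) μ) :
    expNeg (∫⁻ x, f x ∂μ) = ENNReal.ofReal (Real.exp (-∫ x, (f x : ℝ) ∂μ)) := by
  rw [← expNeg_ofReal (integral_nonneg fun x => (f x).coe_nonneg),
    ofReal_integral_eq_lintegral_ofReal hf (ae_of_all _ fun x => (f x).coe_nonneg)]
  simp

theorem integrable_coe_of_le {μ : Measure X} [IsFiniteMeasure μ] {f : X → ℝ≥0}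
    (hf : Measurable f) {C : ℝ≥0} (hC : ∀ x, f x ≤ C) : Integrable (fun x => (f x : ℝ)) μ :=
  Integrable.of_bound (by fun_prop) (C : ℝ) (ae_of_all _ fun x => by simpa using hC x)

/-! ### The Laplace functional on unbounded functions, and its almost sure consequences. -/

section Laplace

variable {ν : Measure X} {P : Measure (DiscreteCone X)}

theorem IsGammaMeasure.lintegral_expNeg_of_le [IsFiniteMeasure ν] (hP : IsGammaMeasure ν P)
    {f : X → ℝ≥0} (hf : Measurable f) {C : ℝ≥0} (hC : ∀ x, f x ≤ C) :
    ∫⁻ η, expNeg (∫⁻ x, f x ∂(η : Measure X)) ∂P =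
      expNeg (∫⁻ x, ENNReal.ofReal (Real.log (1 + f x)) ∂ν) := by
  have := hP.isProbabilityMeasure
  have hlog : ∀ x, 0 ≤ Real.log (1 + f x) := fun x => Real.log_nonneg (by simp)
  have hlogint : Integrable (fun x => Real.log (1 + f x)) ν := by
    refine Integrable.of_bound (Measurable.aestronglyMeasurable (by fun_prop)) (C : ℝ)
      (ae_of_all _ fun x => ?_)
    rw [Real.norm_of_nonneg (hlog x)]
    have h1 := Real.log_le_sub_one_of_pos (show (0 : ℝ) < 1 + f x by positivity)
    have h2 : (f x : ℝ) ≤ C := hC x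
    linarith
  have h := hP.laplace (fun x => f x) (by fun_prop) (fun x => (f x).coe_nonneg) ⟨C, fun x => hC x⟩
  have h1 : ∀ η : DiscreteCone X, Real.exp (-∫ x, (f x : ℝ) ∂(η : Measure X)) =
      (expNeg (∫⁻ x, f x ∂(η : Measure X))).toReal := fun η => by
    rw [expNeg_lintegral_coe (integrable_coe_of_le hf hC),
      ENNReal.toReal_ofReal (Real.exp_pos _).le]
  have h2 : ∫ x, Real.log (levyLaplace gammaLevyMeasure (f x)) ∂ν =
      -∫ x, Real.log (1 + f x) ∂ν := by
    rw [← integral_neg]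
    refine integral_congr_ae (ae_of_all _ fun x => ?_)
    simp only
    rw [levyLaplace_gammaLevyMeasure (f x).coe_nonneg, Real.log_inv]
  simp_rw [h1] at h
  have hmeas : Measurable fun η : DiscreteCone X => expNeg (∫⁻ x, f x ∂(η : Measure X)) :=
    continuous_expNeg.measurable.comp (measurable_lintegral_discreteCone hf.coe_nnreal_ennreal)
  rw [h2, integral_toReal hmeas.aemeasurable (ae_of_all _ fun η => (expNeg_ne_top _).lt_top)] at h
  rw [← ofReal_integral_eq_lintegral_ofReal hlogint (ae_of_all _ hlog),
    expNeg_ofReal (integral_nonneg hlog), ← h, ENNReal.ofReal_toReal]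
  refine ((lintegral_mono fun η => expNeg_le_one _).trans_lt ?_).ne
  simp

/-- The Laplace functional on unbounded functions. -/
theorem IsGammaMeasure.lintegral_expNeg [IsFiniteMeasure ν] (hP : IsGammaMeasure ν P)
    {f : X → ℝ≥0} (hf : Measurable f) :
    ∫⁻ η, expNeg (∫⁻ x, f x ∂(η : Measure X)) ∂P =
      expNeg (∫⁻ x, ENNReal.ofReal (Real.log (1 + f x)) ∂ν) := by
  have := hP.isProbabilityMeasure
  -- Truncate at height `n`. The inner integrals converge monotonically, possibly to `∞`; the outer
  -- one converges by domination by `1`.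
  have hg : ∀ n : ℕ, Measurable fun x => min (f x) n := fun n => by fun_prop
  have hmono : ∀ x, Monotone fun n : ℕ => min (f x) (n : ℝ≥0) := fun x m n h =>
    min_le_min_left _ (by exact_mod_cast h)
  have hlim : ∀ x, Tendsto (fun n : ℕ => min (f x) (n : ℝ≥0)) atTop (𝓝 (f x)) := fun x => by
    obtain ⟨N, hN⟩ := exists_nat_ge (f x)
    refine tendsto_const_nhds.congr' ?_
    filter_upwards [eventually_ge_atTop N] with n hn
    rw [min_eq_left (hN.trans (by exact_mod_cast hn))]
  have hL : ∀ n : ℕ, ∫⁻ η, expNeg (∫⁻ x, (min (f x) n : ℝ≥0) ∂(η : Measure X)) ∂P =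
      expNeg (∫⁻ x, ENNReal.ofReal (Real.log (1 + (min (f x) n : ℝ≥0))) ∂ν) := fun n =>
    hP.lintegral_expNeg_of_le (hg n) (C := n) fun x => min_le_right _ _
  have hleft : Tendsto (fun n : ℕ => ∫⁻ η, expNeg (∫⁻ x, (min (f x) n : ℝ≥0) ∂(η : Measure X)) ∂P)
      atTop (𝓝 (∫⁻ η, expNeg (∫⁻ x, f x ∂(η : Measure X)) ∂P)) := by
    refine tendsto_lintegral_of_dominated_convergence (fun _ => 1)
      (fun n => continuous_expNeg.measurable.comp
        (measurable_lintegral_discreteCone (hg n).coe_nnreal_ennreal))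
      (fun n => ae_of_all _ fun η => expNeg_le_one _) (by simp) (ae_of_all _ fun η => ?_)
    refine (continuous_expNeg.tendsto _).comp ?_
    refine lintegral_tendsto_of_tendsto_of_monotone
      (fun n => (hg n).coe_nnreal_ennreal.aemeasurable)
      (ae_of_all _ fun x m n h => ENNReal.coe_le_coe.2 (hmono x h))
      (ae_of_all _ fun x => by exact_mod_cast hlim x)
  have hright : Tendsto (fun n : ℕ =>
      expNeg (∫⁻ x, ENNReal.ofReal (Real.log (1 + (min (f x) n : ℝ≥0))) ∂ν))
      atTop (𝓝 (expNeg (∫⁻ x, ENNReal.ofReal (Real.log (1 + f x)) ∂ν))) := by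
    refine (continuous_expNeg.tendsto _).comp ?_
    refine lintegral_tendsto_of_tendsto_of_monotone (fun n => ?_)
      (ae_of_all _ fun x m n h => ?_) (ae_of_all _ fun x => ?_)
    · have := hg n
      fun_prop
    · refine ENNReal.ofReal_le_ofReal (Real.log_le_log (by positivity) ?_)
      have : ((min (f x) m : ℝ≥0) : ℝ) ≤ (min (f x) n : ℝ≥0) := hmono x h
      linarith
    · refine (ENNReal.continuous_ofReal.tendsto _).comp ?_
      refine (Real.continuousAt_log (by positivity)).tendsto.comp ?_
      exact tendsto_const_nhds.add (NNReal.tendsto_coe.2 (hlim x))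
  simp_rw [hL] at hleft
  exact tendsto_nhds_unique hleft hright

/-- For `t > 0`, `exp (-t ∫ f dη)` is at most the indicator of `∫ f dη < ∞`, because `exp (-∞) = 0`.
Its expectation `exp (-∫ log (1 + t f) dν)` tends to `1` as `t → 0`, by domination by `log (1 + f)`,
so the event has probability one. -/
theorem IsGammaMeasure.ae_lintegral_lt_top [IsFiniteMeasure ν] (hP : IsGammaMeasure ν P)
    {f : X → ℝ≥0} (hf : Measurable f) (hfin : ∫⁻ x, ENNReal.ofReal (Real.log (1 + f x)) ∂ν ≠ ∞) :
    ∀ᵐ η : DiscreteCone X ∂P, ∫⁻ x, f x ∂(η : Measure X) < ∞ := by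
  have := hP.isProbabilityMeasure
  let t : ℕ → ℝ≥0 := fun n => ((n : ℝ≥0) + 1)⁻¹
  have ht : Tendsto t atTop (𝓝 0) := by
    simpa [t] using tendsto_one_div_add_atTop_nhds_zero_nat (𝕜 := ℝ≥0)
  have ht1 : ∀ n, t n ≤ 1 := fun n => inv_le_one_of_one_le₀ (by simp)
  have ht0 : ∀ n, t n ≠ 0 := fun n => by positivity
  have hmeas := measurable_lintegral_discreteCone hf.coe_nnreal_ennreal
  have hS : MeasurableSet {η : DiscreteCone X | ∫⁻ x, f x ∂(η : Measure X) < ∞} :=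
    measurableSet_lt hmeas measurable_const
  have hlim : Tendsto (fun n => expNeg (∫⁻ x, ENNReal.ofReal (Real.log (1 + (t n * f x : ℝ≥0))) ∂ν))
      atTop (𝓝 1) := by
    have h0 : expNeg (∫⁻ x, ENNReal.ofReal (Real.log (1 + (0 * f x : ℝ≥0))) ∂ν) = 1 := by simp
    rw [← h0]
    refine (continuous_expNeg.tendsto _).comp ?_
    refine tendsto_lintegral_of_dominated_convergence _ (fun n => by fun_prop)
      (fun n => ae_of_all _ fun x => ?_) hfin (ae_of_all _ fun x => ?_)
    · refine ENNReal.ofReal_le_ofReal (Real.log_le_log (by positivity) ?_)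
      have : ((t n * f x : ℝ≥0) : ℝ) ≤ f x := by
        exact_mod_cast mul_le_of_le_one_left zero_le (ht1 n)
      linarith
    · refine (ENNReal.continuous_ofReal.tendsto _).comp ?_
      refine (Real.continuousAt_log (by positivity)).tendsto.comp ?_
      exact tendsto_const_nhds.add (NNReal.tendsto_coe.2 (ht.mul_const _))
  have hle : ∀ n, expNeg (∫⁻ x, ENNReal.ofReal (Real.log (1 + (t n * f x : ℝ≥0))) ∂ν) ≤
      P {η : DiscreteCone X | ∫⁻ x, f x ∂(η : Measure X) < ∞} := fun n => by
    rw [← hP.lintegral_expNeg (f := fun x => t n * f x) (by fun_prop), ← lintegral_indicator_one hS]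
    refine lintegral_mono fun η => ?_
    by_cases hη : η ∈ {η : DiscreteCone X | ∫⁻ x, f x ∂(η : Measure X) < ∞}
    · simpa [Set.indicator_of_mem hη] using expNeg_le_one _
    · have : ∫⁻ x, f x ∂(η : Measure X) = ∞ := by simpa using hη
      simp only [ENNReal.coe_mul]
      rw [lintegral_const_mul _ (by fun_prop), this, ENNReal.mul_top (by exact_mod_cast ht0 n)]
      simp
  exact (mem_ae_iff_prob_eq_one hS).2
    (le_antisymm prob_le_one (le_of_tendsto' hlim hle))

/-- Properties that hold `ν`-almost everywhere hold `η`-almost everywhere, for almost every `η`. -/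
theorem IsGammaMeasure.ae_ae [IsFiniteMeasure ν] (hP : IsGammaMeasure ν P) {p : X → Prop}
    (hp : ∀ᵐ x ∂ν, p x) : ∀ᵐ η : DiscreteCone X ∂P, ∀ᵐ x ∂(η : Measure X), p x := by
  have := hP.isProbabilityMeasure
  obtain ⟨N, hN, hNm, hN0⟩ := exists_measurable_superset_of_null (ae_iff.1 hp)
  -- At the indicator of a null set the functional equals `1`. Since `exp (-η N) ≤ 1`, it must be
  -- `1` almost surely, that is `η N = 0`.
  have hlap := hP.lintegral_expNeg (f := N.indicator 1) (measurable_one.indicator hNm)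
  have h0 : ∫⁻ x, ENNReal.ofReal (Real.log (1 + (N.indicator 1 x : ℝ≥0))) ∂ν = 0 := by
    rw [lintegral_eq_zero_iff' (Measurable.aemeasurable (by
      have : Measurable (N.indicator (1 : X → ℝ≥0)) := measurable_one.indicator hNm
      fun_prop))]
    filter_upwards [measure_eq_zero_iff_ae_notMem.1 hN0] with x hx
    simp [hx]
  have h1 : ∀ η : DiscreteCone X, ∫⁻ x, (N.indicator (1 : X → ℝ≥0) x : ℝ≥0) ∂(η : Measure X) =
      (η : Measure X) N := fun η => by
    rw [← lintegral_indicator_one hNm]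
    refine lintegral_congr fun x => ?_
    by_cases hx : x ∈ N <;> simp [hx]
  simp_rw [h1, h0, expNeg_zero] at hlap
  have hmeas : Measurable fun η : DiscreteCone X => (η : Measure X) N :=
    (Measure.measurable_coe hNm).comp measurable_subtype_coe
  have h2 : (fun η : DiscreteCone X => expNeg ((η : Measure X) N)) =ᵐ[P] fun _ => 1 := by
    refine ae_eq_of_ae_le_of_lintegral_le (ae_of_all _ fun η => expNeg_le_one _) ?_
      aemeasurable_const ?_ <;> simp [hlap]
  filter_upwards [h2] with η hη
  refine ae_iff.2 (measure_mono_null hN ?_)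
  simp only [expNeg] at hη
  rw [← EReal.exp_zero, EReal.exp_strictMono.injective.eq_iff] at hη
  simpa using hη

end Laplace

/-! ### The Laplace functional determines the law. -/

/-- A finite measure on a finite-dimensional cube is determined by its moments. -/
theorem ext_of_integral_prod_pow_eq {J : Type*} [Fintype J] {μ μ' : Measure (J → unitInterval)}
    [IsFiniteMeasure μ] [IsFiniteMeasure μ']
    (h : ∀ k : J → ℕ, ∫ x, ∏ j, (x j : ℝ) ^ k j ∂μ = ∫ x, ∏ j, (x j : ℝ) ^ k j ∂μ') : μ = μ' := by
  let mono : (J → ℕ) → BoundedContinuousFunction (J → unitInterval) ℝ := fun k =>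
    BoundedContinuousFunction.mkOfCompact ⟨fun x => ∏ j, (x j : ℝ) ^ k j, by fun_prop⟩
  have hmono : ∀ k x, mono k x = ∏ j, (x j : ℝ) ^ k j := fun k x => rfl
  let A := StarAlgebra.adjoin ℝ (Set.range mono)
  refine ext_of_forall_mem_subalgebra_integral_eq_of_polish (𝕜 := ℝ) (A := A) ?_ ?_
  · intro x y hxy
    obtain ⟨j, hj⟩ := Function.ne_iff.1 hxy
    classical
    -- The monomial with exponent `Pi.single j 1` is the `j`-th coordinate, which separates `x` and
    -- `y`.
    refine ⟨_, ⟨_, ⟨mono (Pi.single j 1), StarAlgebra.subset_adjoin ℝ _ ⟨_, rfl⟩, rfl⟩, rfl⟩, ?_⟩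
    have hval : ∀ z, mono (Pi.single j 1) z = z j := fun z => by
      rw [hmono, Finset.prod_eq_single j] <;> simp +contextual
    have : mono (Pi.single j 1) x ≠ mono (Pi.single j 1) y := by
      rw [hval, hval]
      exact fun h => hj (Subtype.ext h)
    exact this
  · intro g hg
    have hg' : g ∈ Subalgebra.toSubmodule A.toSubalgebra := hg
    rw [StarAlgebra.adjoin_eq_span] at hg'
    clear hg
    -- Monomials are closed under products and fixed by `star`, so the star algebra is their linear
    -- span and equality of moments extends by linearity.
    have hclosure : ∀ f ∈ Submonoid.closure (Set.range mono ∪ star (Set.range mono)),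
        f ∈ Set.range mono := fun f hf => by
      induction hf using Submonoid.closure_induction with
      | mem f hf =>
        rcases hf with hf | ⟨k, hk⟩
        · exact hf
        · refine ⟨k, ?_⟩
          rw [hk]
          ext x
          simp
      | one => exact ⟨0, by ext x; simp [hmono]⟩
      | mul f g _ _ hf hg =>
        obtain ⟨k, rfl⟩ := hf
        obtain ⟨l, rfl⟩ := hg
        exact ⟨k + l, by ext x; simp [hmono, pow_add, Finset.prod_mul_distrib]⟩
    induction hg' using Submodule.span_induction with
    | mem f hf =>
      obtain ⟨k, rfl⟩ := hclosure f hf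
      exact h k
    | zero => simp
    | add f g _ _ hf hg =>
      simp only [BoundedContinuousFunction.coe_add, Pi.add_apply]
      rw [integral_add (f.integrable _) (g.integrable _),
        integral_add (f.integrable _) (g.integrable _), hf, hg]
    | smul c f _ hf =>
      simp only [BoundedContinuousFunction.coe_smul]
      rw [integral_smul, integral_smul, hf]

/-- The coordinates `η ↦ exp (-η A)`, over all measurable sets `A`. -/
noncomputable def expCoord (η : DiscreteCone X) (A : {A : Set X // MeasurableSet A}) :
    unitInterval :=
  ⟨Real.exp (-(η : Measure X).real A), (Real.exp_pos _).le,
    Real.exp_le_one_iff.2 (neg_nonpos.2 measureReal_nonneg)⟩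

theorem measurable_expCoord : Measurable (expCoord : DiscreteCone X → _) := by
  refine measurable_pi_lambda _ fun A => Measurable.subtype_mk ?_
  have : Measurable fun η : DiscreteCone X => (η : Measure X) A :=
    (Measure.measurable_coe A.2).comp measurable_subtype_coe
  exact (this.ennreal_toReal.neg).exp

/-- Each `η A` is finite, hence recovered as `-log` of a coordinate. The coordinates therefore
generate the `σ`-algebra, and laws on the cone can be compared after mapping to the cube. -/
theorem exists_preimage_expCoord {s : Set (DiscreteCone X)} (hs : MeasurableSet s) :
    ∃ t, MeasurableSet t ∧ expCoord ⁻¹' t = s := by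
  have hle : (inferInstance : MeasurableSpace (DiscreteCone X)) ≤
      MeasurableSpace.comap expCoord inferInstance := by
    change MeasurableSpace.comap Subtype.val Measure.instMeasurableSpace ≤ _
    rw [Measure.instMeasurableSpace]
    simp only [MeasurableSpace.comap_iSup, MeasurableSpace.comap_comp]
    refine iSup₂_le fun A hA => ?_
    let g : ({A : Set X // MeasurableSet A} → unitInterval) → ℝ≥0∞ := fun u =>
      ENNReal.ofReal (-Real.log (u ⟨A, hA⟩))
    have hg : Measurable g := by fun_prop
    have hcomp : (fun μ : Measure X => μ A) ∘ Subtype.val =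
        g ∘ (expCoord : DiscreteCone X → _) := by
      ext η
      simp [g, expCoord]
    rw [hcomp, ← MeasurableSpace.comap_comp]
    exact MeasurableSpace.comap_mono hg.comap_le
  exact hle s hs

/-- The law of a random discrete measure is determined by its Laplace functional. -/
theorem ext_of_laplace {Q Q' : Measure (DiscreteCone X)} [IsFiniteMeasure Q] [IsFiniteMeasure Q']
    (h : ∀ f : X → ℝ≥0, Measurable f → (∃ C, ∀ x, f x ≤ C) →
      ∫⁻ η, expNeg (∫⁻ x, f x ∂(η : Measure X)) ∂Q =
        ∫⁻ η, expNeg (∫⁻ x, f x ∂(η : Measure X)) ∂Q') : Q = Q' := by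
  have hmap : Q.map expCoord = Q'.map expCoord := by
    -- A finite measure on the infinite cube is determined by its finite-dimensional projections,
    -- and those by their moments.
    refine IsProjectiveLimit.unique (P := fun J => (Q.map expCoord).map J.restrict)
      (fun J => rfl) fun J => ?_
    refine ext_of_integral_prod_pow_eq fun k => ?_
    have hJ : Measurable (J.restrict (π := fun _ : {A : Set X // MeasurableSet A} => unitInterval)) :=
      J.measurable_restrict
    have hcont : Continuous fun x : J → unitInterval => ∏ j, (x j : ℝ) ^ k j := by fun_prop
    -- The monomial `∏ exp (-η A_j) ^ k_j` equals `exp (-∫ f dη)` for this simple function, so every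
    -- moment is a value of the Laplace functional.
    let f : X → ℝ≥0 := fun x => ∑ j : J, k j * (j : Set X).indicator 1 x
    have hind : ∀ j : J, Measurable ((j : Set X).indicator (1 : X → ℝ≥0)) := fun j =>
      measurable_one.indicator j.1.2
    have hf : Measurable f := Finset.measurable_fun_sum _ fun j _ => (hind j).const_mul _
    have hfC : ∀ x, f x ≤ ∑ j : J, (k j : ℝ≥0) := fun x =>
      Finset.sum_le_sum fun j _ => mul_le_of_le_one_right zero_le
        (Set.indicator_le_self' (fun _ _ => zero_le) x)
    have hint : ∀ η : DiscreteCone X, ∫ x, (f x : ℝ) ∂(η : Measure X) =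
        ∑ j : J, k j * (η : Measure X).real j := fun η => by
      have hfx : ∀ x, (f x : ℝ) = ∑ j : J, k j * (j : Set X).indicator (1 : X → ℝ) x := fun x => by
        simp only [f, NNReal.coe_sum, NNReal.coe_mul, NNReal.coe_natCast]
        refine Finset.sum_congr rfl fun j _ => ?_
        by_cases hx : x ∈ (j : Set X) <;> simp [hx]
      simp_rw [hfx]
      rw [integral_finsetSum]
      · simp_rw [integral_const_mul]
        refine Finset.sum_congr rfl fun j _ => ?_
        rw [integral_indicator_one j.1.2]
      · exact fun j _ => ((integrable_const 1).indicator j.1.2).const_mul _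
    have hprod : ∀ η : DiscreteCone X, ∏ j : J, ((J.restrict (expCoord η) j : unitInterval) : ℝ) ^ k j =
        (expNeg (∫⁻ x, f x ∂(η : Measure X))).toReal := fun η => by
      rw [expNeg_lintegral_coe (integrable_coe_of_le hf hfC), hint,
        ENNReal.toReal_ofReal (Real.exp_pos _).le, ← Finset.sum_neg_distrib, Real.exp_sum]
      refine Finset.prod_congr rfl fun j _ => ?_
      rw [← mul_neg, Real.exp_nat_mul]
      rfl
    have hmeas : Measurable fun η : DiscreteCone X => expNeg (∫⁻ x, f x ∂(η : Measure X)) :=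
      continuous_expNeg.measurable.comp (measurable_lintegral_discreteCone hf.coe_nnreal_ennreal)
    have hmap : ∀ (ρ : Measure (DiscreteCone X)),
        ∫ x, ∏ j, (x j : ℝ) ^ k j ∂((ρ.map expCoord).map J.restrict) =
          (∫⁻ η : DiscreteCone X, expNeg (∫⁻ x, f x ∂(η : Measure X)) ∂ρ).toReal := fun ρ => by
      rw [Measure.map_map hJ measurable_expCoord,
        integral_map (hJ.comp measurable_expCoord).aemeasurable hcont.aestronglyMeasurable,
        ← integral_toReal hmeas.aemeasurable (ae_of_all _ fun η => (expNeg_ne_top _).lt_top)]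
      exact integral_congr_ae (ae_of_all _ hprod)
    exact (hmap Q').trans ((congrArg _ (h f hf ⟨_, hfC⟩).symm).trans (hmap Q).symm)
  ext s hs
  obtain ⟨t, ht, rfl⟩ := exists_preimage_expCoord hs
  rw [← Measure.map_apply measurable_expCoord ht, hmap, Measure.map_apply measurable_expCoord ht]

/-- The difference of the integrals of the positive and negative parts is measurable in `η`, but
need not agree with the Bochner integral where `g` is not integrable. -/
theorem aemeasurable_integral {P : Measure (DiscreteCone X)} {g : X → ℝ} (hg : Measurable g)
    (hint : ∀ᵐ η : DiscreteCone X ∂P, Integrable g (η : Measure X)) :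
    AEMeasurable (fun η : DiscreteCone X => ∫ x, g x ∂(η : Measure X)) P := by
  refine ⟨fun η => (∫⁻ x, ENNReal.ofReal (g x) ∂(η : Measure X)).toReal -
    (∫⁻ x, ENNReal.ofReal (-g x) ∂(η : Measure X)).toReal, ?_, ?_⟩
  · exact (measurable_lintegral_discreteCone (by fun_prop)).ennreal_toReal.sub
      (measurable_lintegral_discreteCone (by fun_prop)).ennreal_toReal
  · filter_upwards [hint] with η hη
    exact integral_eq_lintegral_pos_part_sub_lintegral_neg_part hη

/-! ### Signed integrands and integrability of logarithms. -/

variable {ν : Measure X} {P : Measure (DiscreteCone X)}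

/-- Almost sure integrability of `g` from the integrability of `log (1 + |g|)`. -/
theorem IsGammaMeasure.ae_integrable [IsFiniteMeasure ν] (hP : IsGammaMeasure ν P) {g : X → ℝ}
    (hg : Measurable g) (hlog : Integrable (fun x => Real.log (1 + |g x|)) ν) :
    ∀ᵐ η : DiscreteCone X ∂P, Integrable g (η : Measure X) := by
  have h := hP.ae_lintegral_lt_top (f := fun x => ‖g x‖₊) (by fun_prop) (by
    simp only [coe_nnnorm, Real.norm_eq_abs]
    exact hlog.lintegral_lt_top.ne)
  filter_upwards [h] with η hη
  exact ⟨hg.aestronglyMeasurable, hη⟩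

/-- The Laplace functional at a function `g > -1`. -/
def LaplaceAt (ν : Measure X) (P : Measure (DiscreteCone X)) (g : X → ℝ) : Prop :=
  ∫⁻ η : DiscreteCone X, ENNReal.ofReal (Real.exp (-∫ x, g x ∂(η : Measure X))) ∂P =
    ENNReal.ofReal (Real.exp (-∫ x, Real.log (1 + g x) ∂ν))

theorem IsGammaMeasure.laplaceAt_of_nonneg [IsFiniteMeasure ν] (hP : IsGammaMeasure ν P)
    {g : X → ℝ} (hg : Measurable g) (hg0 : ∀ x, 0 ≤ g x)
    (hlog : Integrable (fun x => Real.log (1 + g x)) ν) : LaplaceAt ν P g := by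
  have hint := hP.ae_integrable hg (by simpa only [abs_of_nonneg (hg0 _)] using hlog)
  have hcoe : ∀ x, ((g x).toNNReal : ℝ) = g x := fun x => Real.coe_toNNReal _ (hg0 x)
  have h := hP.lintegral_expNeg (f := fun x => (g x).toNNReal) (by fun_prop)
  simp only [hcoe] at h
  have hlog0 : ∀ x, 0 ≤ Real.log (1 + g x) := fun x => Real.log_nonneg (by linarith [hg0 x])
  rw [← ofReal_integral_eq_lintegral_ofReal hlog (ae_of_all _ hlog0),
    expNeg_ofReal (integral_nonneg hlog0)] at h
  rw [LaplaceAt, ← h]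
  refine lintegral_congr_ae ?_
  filter_upwards [hint] with η hη
  rw [expNeg_lintegral_coe (by simpa only [hcoe] using hη)]
  simp only [hcoe]

theorem log_one_add_le {x : ℝ} (hx : 0 ≤ x) : Real.log (1 + x) ≤ Real.log 2 + |Real.log x| := by
  rcases hx.eq_or_lt with rfl | hx
  · simp [Real.log_nonneg]
  rcases le_total x 1 with h | h
  · have : Real.log (1 + x) ≤ Real.log 2 := Real.log_le_log (by positivity) (by linarith)
    linarith [abs_nonneg (Real.log x)]
  · rw [abs_of_nonneg (Real.log_nonneg h), ← Real.log_mul (by norm_num) hx.ne']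
    exact Real.log_le_log (by positivity) (by linarith)

theorem integrable_log_one_add [IsFiniteMeasure ν] {f : X → ℝ} (hf : Measurable f)
    (hf0 : ∀ x, 0 ≤ f x) (hlog : Integrable (fun x => Real.log (f x)) ν) :
    Integrable (fun x => Real.log (1 + f x)) ν := by
  refine Integrable.mono' ((integrable_const (Real.log 2)).add hlog.abs)
    (Measurable.aestronglyMeasurable (by fun_prop)) (ae_of_all _ fun x => ?_)
  rw [Real.norm_of_nonneg (Real.log_nonneg (by linarith [hf0 x]))]
  exact log_one_add_le (hf0 x)

theorem HasSummableLog.integrable_log_inv {a : X → ℝ≥0} (ha : HasSummableLog ν a) :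
    Integrable (fun x => Real.log (1 / (a x : ℝ))) ν := by
  simpa [Real.log_inv] using ha.integrable_log.neg

theorem HasSummableLog.integrable_log_one_add_mul [IsFiniteMeasure ν] {a b : X → ℝ≥0}
    (ha : HasSummableLog ν a) (ham : Measurable a) (hb : Measurable b) {C : ℝ≥0}
    (hC : ∀ x, b x ≤ C) : Integrable (fun x => Real.log (1 + (a x * b x : ℝ≥0))) ν := by
  refine Integrable.mono' (((integrable_const (Real.log (1 + C))).add
    (integrable_const (Real.log 2))).add ha.integrable_log.abs)
    (Measurable.aestronglyMeasurable (by fun_prop)) (ae_of_all _ fun x => ?_)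
  have hCx : (b x : ℝ) ≤ C := hC x
  have ha0' : (0 : ℝ) ≤ a x := (a x).coe_nonneg
  rw [Real.norm_of_nonneg (Real.log_nonneg (by simp [mul_nonneg]))]
  calc Real.log (1 + (a x * b x : ℝ≥0)) ≤ Real.log ((1 + C) * (1 + a x)) := by
        refine Real.log_le_log (by positivity) ?_
        push_cast
        nlinarith [C.coe_nonneg]
    _ = Real.log (1 + C) + Real.log (1 + a x) := Real.log_mul (by positivity) (by positivity)
    _ ≤ _ := by
      have := log_one_add_le ha0'
      simp only [Pi.add_apply]
      linarith

/-- This is `1/a + b = (1 + a b) / a`. The term `-log a` is what the constant factor of the density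
compensates. -/
theorem log_one_add_inv_sub_one_add {a b : ℝ≥0} (ha : 0 < a) :
    Real.log (1 + (1 / (a : ℝ) - 1 + b)) = Real.log (1 + (a * b : ℝ≥0)) - Real.log a := by
  have ha' : (0 : ℝ) < a := ha
  simp only [NNReal.coe_mul]
  rw [← Real.log_div (by positivity) (by positivity)]
  congr 1
  field_simp
  ring

theorem HasSummableLog.ae_lintegral_lt_top [IsFiniteMeasure ν] (hP : IsGammaMeasure ν P)
    {a : X → ℝ≥0} (ha : HasSummableLog ν a) (ham : Measurable a) :
    ∀ᵐ η : DiscreteCone X ∂P, ∫⁻ x, a x ∂(η : Measure X) < ∞ :=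
  hP.ae_lintegral_lt_top ham (integrable_log_one_add (by fun_prop) (fun x => (a x).coe_nonneg)
    ha.integrable_log).lintegral_lt_top.ne

/-- Summability of the logarithm is invariant under `a ↦ 1/a`, so `1/a` is almost surely integrable;
the constant `1` is too, as `η` is finite. -/
theorem HasSummableLog.ae_integrable [IsFiniteMeasure ν] (hP : IsGammaMeasure ν P)
    {a : X → ℝ≥0} (ha : HasSummableLog ν a) (ham : Measurable a) :
    ∀ᵐ η : DiscreteCone X ∂P, Integrable (fun x => 1 / (a x : ℝ) - 1) (η : Measure X) := by
  have h0 : ∀ x, 0 ≤ 1 / (a x : ℝ) := fun x => by positivity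
  have h := hP.ae_integrable (g := fun x => 1 / (a x : ℝ)) (by fun_prop) (by
    simp only [abs_of_nonneg (h0 _)]
    exact integrable_log_one_add (by fun_prop) h0 ha.integrable_log_inv)
  filter_upwards [h] with η hη
  exact hη.sub (integrable_const 1)

/-! ### The multiplicator and its density. -/

section Multiplicator

variable [MeasurableSingletonClass X]

theorem coe_multiplicator {a : X → ℝ≥0} {η : DiscreteCone X}
    (h : ∫⁻ x, a x ∂(η : Measure X) ≠ ∞) :
    (multiplicator a η : Measure X) = (η : Measure X).withDensity fun x => (a x : ℝ≥0∞) := by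
  rw [multiplicator, dif_pos h]

theorem measurable_multiplicator {a : X → ℝ≥0} (ham : Measurable a) :
    Measurable (multiplicator a : DiscreteCone X → DiscreteCone X) := by
  classical
  have hS : MeasurableSet {η : DiscreteCone X | ∫⁻ x, a x ∂(η : Measure X) ≠ ∞} :=
    (measurableSet_eq_fun (measurable_lintegral_discreteCone ham.coe_nnreal_ennreal)
      measurable_const).compl
  have hval : (fun η => (multiplicator a η : Measure X)) = fun η : DiscreteCone X =>
      if ∫⁻ x, a x ∂(η : Measure X) ≠ ∞ then
        (η : Measure X).withDensity fun x => (a x : ℝ≥0∞) else 0 := by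
    ext1 η
    rw [multiplicator]
    split_ifs <;> rfl
  have h : Measurable fun η => (multiplicator a η : Measure X) := by
    rw [hval]
    refine Measurable.ite hS (Measure.measurable_of_measurable_coe _ fun A hA => ?_)
      measurable_const
    simp only [withDensity_apply _ hA, ← lintegral_indicator hA]
    exact measurable_lintegral_discreteCone (ham.coe_nnreal_ennreal.indicator hA)
  exact h.subtype_mk

/-- `M_a P` has density `multiplicatorDensity` with respect to `P`. -/
def HasMultiplicatorDensity (ν : Measure X) (P : Measure (DiscreteCone X)) (a : X → ℝ≥0) : Prop :=
  P.map (multiplicator a) =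
    P.withDensity fun η => ENNReal.ofReal (multiplicatorDensity ν a η)

/-- The density formula for `M_a` follows from the Laplace functional on the functions
`1 / a - 1 + b`, with `b` non-negative and bounded. -/
theorem IsGammaMeasure.hasMultiplicatorDensity_of_laplaceAt [IsFiniteMeasure ν]
    (hP : IsGammaMeasure ν P) {a : X → ℝ≥0} (ha : HasSummableLog ν a) (ham : Measurable a)
    (ha0 : ∀ x, 0 < a x)
    (h : ∀ b : X → ℝ≥0, Measurable b → (∃ C, ∀ x, b x ≤ C) →
      LaplaceAt ν P fun x => 1 / (a x : ℝ) - 1 + b x) : HasMultiplicatorDensity ν P a := by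
  have := hP.isProbabilityMeasure
  have hM := measurable_multiplicator ham
  have haint := ha.ae_integrable hP ham
  have hD : AEMeasurable (fun η => ENNReal.ofReal (multiplicatorDensity ν a η)) P :=
    ((aemeasurable_integral (by fun_prop) haint).neg.exp.const_mul _).ennreal_ofReal
  -- Both Laplace functionals are computed to the same closed form; for the image law because `∫ b
  -- d(aη) = ∫ a b dη`.
  have key : ∀ b : X → ℝ≥0, Measurable b → (∃ C, ∀ x, b x ≤ C) →
      ∫⁻ η, expNeg (∫⁻ x, b x ∂(η : Measure X)) ∂(P.map (multiplicator a)) =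
        ENNReal.ofReal (Real.exp (-∫ x, Real.log (1 + (a x * b x : ℝ≥0)) ∂ν)) ∧
      ∫⁻ η, expNeg (∫⁻ x, b x ∂(η : Measure X))
          ∂(P.withDensity fun η => ENNReal.ofReal (multiplicatorDensity ν a η)) =
        ENNReal.ofReal (Real.exp (-∫ x, Real.log (1 + (a x * b x : ℝ≥0)) ∂ν)) := by
    intro b hb hbC
    have hbm : Measurable fun η : DiscreteCone X => expNeg (∫⁻ x, b x ∂(η : Measure X)) :=
      continuous_expNeg.measurable.comp (measurable_lintegral_discreteCone hb.coe_nnreal_ennreal)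
    obtain ⟨C, hC⟩ := hbC
    have hlog := ha.integrable_log_one_add_mul ham hb hC
    constructor
    · rw [lintegral_map hbm hM]
      have hlog0 : ∀ x, 0 ≤ Real.log (1 + (a x * b x : ℝ≥0)) := fun x =>
        Real.log_nonneg (by simp [mul_nonneg])
      have h1 := hP.lintegral_expNeg (f := fun x => a x * b x) (by fun_prop)
      rw [← ofReal_integral_eq_lintegral_ofReal hlog (ae_of_all _ hlog0),
        expNeg_ofReal (integral_nonneg hlog0)] at h1
      rw [← h1]
      refine lintegral_congr_ae ?_
      filter_upwards [ha.ae_lintegral_lt_top hP ham] with η hη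
      rw [coe_multiplicator hη.ne, lintegral_withDensity_eq_lintegral_mul _ (by fun_prop)
        (by fun_prop)]
      simp
    · rw [lintegral_withDensity_eq_lintegral_mul₀ hD hbm.aemeasurable]
      have h1 : ∫ x, Real.log (1 + (1 / (a x : ℝ) - 1 + b x)) ∂ν =
          ∫ x, Real.log (1 + (a x * b x : ℝ≥0)) ∂ν - ∫ x, Real.log (a x) ∂ν := by
        rw [← integral_sub hlog ha.integrable_log]
        refine integral_congr_ae (ae_of_all _ fun x => ?_)
        exact log_one_add_inv_sub_one_add (ha0 x)
      have h2 := h b hb ⟨C, hC⟩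
      rw [LaplaceAt, h1] at h2
      have h3 : Real.exp (-∫ x, Real.log (1 + (a x * b x : ℝ≥0)) ∂ν) =
          Real.exp (-∫ x, Real.log (a x) ∂ν) *
            Real.exp (-(∫ x, Real.log (1 + (a x * b x : ℝ≥0)) ∂ν - ∫ x, Real.log (a x) ∂ν)) := by
        rw [← Real.exp_add]
        ring_nf
      rw [h3, ENNReal.ofReal_mul (Real.exp_pos _).le, ← h2,
        ← lintegral_const_mul' _ _ ENNReal.ofReal_ne_top]
      refine lintegral_congr_ae ?_
      filter_upwards [haint] with η hη
      have hbint := integrable_coe_of_le (μ := (η : Measure X)) hb hC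
      rw [Pi.mul_apply, expNeg_lintegral_coe hbint, multiplicatorDensity,
        integral_add hη hbint, ← ENNReal.ofReal_mul (by positivity),
        ← ENNReal.ofReal_mul (by positivity), mul_assoc, ← Real.exp_add, ← neg_add]
  have hfin : IsFiniteMeasure
      (P.withDensity fun η => ENNReal.ofReal (multiplicatorDensity ν a η)) := by
    refine isFiniteMeasure_withDensity ?_
    -- At `b = 0` the functional is the total mass of the measure.
    have h0 := (key (fun _ => 0) measurable_const ⟨0, fun _ => le_rfl⟩).2
    simp only [ENNReal.coe_zero, lintegral_zero, expNeg_zero] at h0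
    rw [lintegral_one, withDensity_apply _ MeasurableSet.univ, Measure.restrict_univ] at h0
    rw [h0]
    exact ENNReal.ofReal_ne_top
  have := Measure.isFiniteMeasure_map P (multiplicator a)
  exact ext_of_laplace fun b hb hbC => ((key b hb hbC).1).trans ((key b hb hbC).2).symm

/-- Here `1/a - 1 + b ≥ 0`, so the functional on non-negative functions is enough. This case serves
as the change of variable in `laplaceAt`. -/
theorem IsGammaMeasure.hasMultiplicatorDensity_of_le_one [IsFiniteMeasure ν]
    (hP : IsGammaMeasure ν P) {a : X → ℝ≥0} (ha : HasSummableLog ν a) (ham : Measurable a)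
    (ha0 : ∀ x, 0 < a x) (ha1 : ∀ x, a x ≤ 1) : HasMultiplicatorDensity ν P a := by
  refine hP.hasMultiplicatorDensity_of_laplaceAt ha ham ha0 fun b hb ⟨C, hC⟩ =>
    hP.laplaceAt_of_nonneg (by fun_prop) (fun x => ?_) ?_
  · have h1 : 1 ≤ 1 / (a x : ℝ) := by
      rw [le_div_iff₀ (show (0 : ℝ) < a x from ha0 x), one_mul]
      exact ha1 x
    have h2 : (0 : ℝ) ≤ b x := (b x).coe_nonneg
    linarith
  · simp only [log_one_add_inv_sub_one_add (ha0 _)]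
    exact (ha.integrable_log_one_add_mul ham hb hC).sub ha.integrable_log

/-- The Laplace functional on functions with values in `(-1, ∞)`, by the change of variable
`η ↦ c η` with `c = min 1 (1 + g)`, which turns `g` into its positive part. -/
theorem IsGammaMeasure.laplaceAt [IsFiniteMeasure ν] (hP : IsGammaMeasure ν P)
    {g : X → ℝ} (hg : Measurable g) (hg1 : ∀ x, -1 < g x)
    (hlog : Integrable (fun x => Real.log (1 + g x)) ν) : LaplaceAt ν P g := by
  let c : X → ℝ≥0 := fun x => (min 1 (1 + g x)).toNNReal
  have hcm : Measurable c := by fun_prop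
  have hgpos : ∀ x, 0 < 1 + g x := fun x => by linarith [hg1 x]
  have hcoe : ∀ x, (c x : ℝ) = min 1 (1 + g x) := fun x =>
    Real.coe_toNNReal _ (le_min zero_le_one (hgpos x).le)
  have hcR : ∀ x, (0 : ℝ) < c x := fun x => by
    rw [hcoe]
    exact lt_min one_pos (hgpos x)
  have hc0 : ∀ x, 0 < c x := hcR
  have hc1 : ∀ x, c x ≤ 1 := fun x => by
    rw [← NNReal.coe_le_coe, hcoe]
    exact min_le_left _ _
  have hcases : ∀ x, (0 ≤ g x ∧ (c x : ℝ) = 1 ∧ max (g x) 0 = g x) ∨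
      (g x < 0 ∧ (c x : ℝ) = 1 + g x ∧ max (g x) 0 = 0) := fun x => by
    rcases le_or_gt 0 (g x) with h | h
    · exact Or.inl ⟨h, by rw [hcoe, min_eq_left (by linarith)], max_eq_left h⟩
    · exact Or.inr ⟨h, by rw [hcoe, min_eq_right (by linarith)], max_eq_right h.le⟩
  have hlogc : Integrable (fun x => Real.log (c x)) ν := by
    refine hlog.mono (Measurable.aestronglyMeasurable (by fun_prop)) (ae_of_all _ fun x => ?_)
    rcases hcases x with ⟨-, h, -⟩ | ⟨-, h, -⟩ <;> simp [h]
  have hlogp : Integrable (fun x => Real.log (1 + max (g x) 0)) ν := by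
    refine hlog.mono (Measurable.aestronglyMeasurable (by fun_prop)) (ae_of_all _ fun x => ?_)
    rcases hcases x with ⟨-, -, h⟩ | ⟨-, -, h⟩ <;> simp [h]
  have hc : HasSummableLog ν c := ⟨hcm.aemeasurable, ae_of_all _ hc0, hlogc⟩
  -- In both cases `log (1 + |g/c|) = |log (1 + g)|`: where `g < 0`, `1 + |g|/(1 + g) = 1/(1 + g)`.
  have hgc : ∀ᵐ η : DiscreteCone X ∂P, Integrable (fun x => g x / c x) (η : Measure X) := by
    refine hP.ae_integrable (by fun_prop) (hlog.abs.congr (ae_of_all _ fun x => ?_))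
    rcases hcases x with ⟨h0, h, -⟩ | ⟨h0, h, -⟩
    · simp only [h, div_one]
      rw [abs_of_nonneg h0, abs_of_nonneg (Real.log_nonneg (by linarith))]
    · have h2 : 1 + |g x / c x| = (1 + g x)⁻¹ := by
        have := (hgpos x).ne'
        rw [abs_of_nonpos (div_nonpos_of_nonpos_of_nonneg h0.le (hcR x).le), h]
        field_simp
        ring
      simp only [h2, Real.log_inv]
      rw [abs_of_nonpos (Real.log_nonpos (hgpos x).le (by linarith))]
  have hdens := hP.hasMultiplicatorDensity_of_le_one hc hcm hc0 hc1
  rw [HasMultiplicatorDensity] at hdens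
  have hint := hc.ae_integrable hP hcm
  have hD : AEMeasurable (fun η => ENNReal.ofReal (multiplicatorDensity ν c η)) P :=
    ((aemeasurable_integral (by fun_prop) hint).neg.exp.const_mul _).ennreal_ofReal
  let F : DiscreteCone X → ℝ≥0∞ := fun η =>
    ENNReal.ofReal (Real.exp (-∫ x, g x / c x ∂(η : Measure X)))
  have hF : AEMeasurable F P := (aemeasurable_integral (by fun_prop) hgc).neg.exp.ennreal_ofReal
  -- The change of variable needs measurability of `F` up to null sets of the image law; absolute
  -- continuity transfers it from `P`.
  have hF' : AEMeasurable F (P.map (multiplicator c)) := by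
    rw [hdens]
    exact hF.mono_ac (withDensity_absolutelyContinuous _ _)
  have hpos := hP.laplaceAt_of_nonneg (g := fun x => max (g x) 0) (by fun_prop)
    (fun x => le_max_right _ _) hlogp
  rw [LaplaceAt] at hpos ⊢
  calc ∫⁻ η : DiscreteCone X, ENNReal.ofReal (Real.exp (-∫ x, g x ∂(η : Measure X))) ∂P
      = ∫⁻ η, F (multiplicator c η) ∂P := by
        refine lintegral_congr_ae ?_
        filter_upwards [hc.ae_lintegral_lt_top hP hcm] with η hη
        simp only [F]
        rw [coe_multiplicator hη.ne, integral_withDensity_eq_integral_smul hcm]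
        congr 4
        ext x
        rw [NNReal.smul_def, smul_eq_mul, mul_div_cancel₀ _ (hcR x).ne']
    _ = ∫⁻ η, F η ∂(P.map (multiplicator c)) :=
        (lintegral_map' hF' (measurable_multiplicator hcm).aemeasurable).symm
    _ = ∫⁻ η, ENNReal.ofReal (multiplicatorDensity ν c η) * F η ∂P := by
        rw [hdens, lintegral_withDensity_eq_lintegral_mul₀ hD hF]
        rfl
    _ = ∫⁻ η : DiscreteCone X, ENNReal.ofReal (Real.exp (-∫ x, Real.log (c x) ∂ν)) *
          ENNReal.ofReal (Real.exp (-∫ x, max (g x) 0 ∂(η : Measure X))) ∂P := by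
        refine lintegral_congr_ae ?_
        filter_upwards [hint, hgc] with η h1 h2
        -- The exponents of the density and of `F` add up to `(1/c - 1) + g/c = (1 + g)/c - 1`, the
        -- positive part of `g`.
        have h3 : ∫ x, max (g x) 0 ∂(η : Measure X) =
            ∫ x, (1 / (c x : ℝ) - 1) ∂(η : Measure X) + ∫ x, g x / c x ∂(η : Measure X) := by
          rw [← integral_add h1 h2]
          refine integral_congr_ae (ae_of_all _ fun x => ?_)
          simp only
          rcases hcases x with ⟨-, h, h'⟩ | ⟨-, h, h'⟩
          · rw [h, h']
            ring
          · have := (hgpos x).ne'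
            rw [h, h']
            field_simp
            ring
        simp only [F]
        rw [multiplicatorDensity, ← ENNReal.ofReal_mul (by positivity),
          ← ENNReal.ofReal_mul (by positivity), mul_assoc, ← Real.exp_add, h3, neg_add]
    _ = ENNReal.ofReal (Real.exp (-∫ x, Real.log (1 + g x) ∂ν)) := by
        rw [lintegral_const_mul' _ _ ENNReal.ofReal_ne_top, hpos,
          ← ENNReal.ofReal_mul (by positivity), ← Real.exp_add, ← neg_add,
          ← integral_add hlogc hlogp]
        -- Pointwise, `c (1 + max g 0) = 1 + g`.
        congr 4
        ext x
        rcases hcases x with ⟨-, h, h'⟩ | ⟨-, h, h'⟩ <;> simp [h, h']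

theorem IsGammaMeasure.hasMultiplicatorDensity [IsFiniteMeasure ν]
    (hP : IsGammaMeasure ν P) {a : X → ℝ≥0} (ha : HasSummableLog ν a) (ham : Measurable a)
    (ha0 : ∀ x, 0 < a x) : HasMultiplicatorDensity ν P a := by
  refine hP.hasMultiplicatorDensity_of_laplaceAt ha ham ha0 fun b hb ⟨C, hC⟩ =>
    hP.laplaceAt (by fun_prop) (fun x => ?_) ?_
  · have h1 : 0 < 1 / (a x : ℝ) := one_div_pos.2 (ha0 x)
    have h2 : (0 : ℝ) ≤ b x := (b x).coe_nonneg
    linarith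
  · simp only [log_one_add_inv_sub_one_add (ha0 _)]
    exact (ha.integrable_log_one_add_mul ham hb hC).sub ha.integrable_log

end Multiplicator

end GammaProcess

/-! ### The theorem, by reduction to a measurable, everywhere positive factor. -/

theorem theorem3 {X : Type*} [MeasurableSpace X] [StandardBorelSpace X]
    (ν : Measure X) [IsFiniteMeasure ν] [NullSingletonClass ν]
    (P : Measure (GammaProcess.DiscreteCone X)) (hP : GammaProcess.IsGammaMeasure ν P)
    (a : X → ℝ≥0) (ha : GammaProcess.HasSummableLog ν a) :
    -- `M_a` is defined `P`-almost everywhere, and is measurable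
    (∀ᵐ η : GammaProcess.DiscreteCone X ∂P, ∫⁻ x, (a x : ℝ≥0∞) ∂(η : Measure X) < ∞) ∧
    AEMeasurable (GammaProcess.multiplicator a) P ∧
    -- quasi-invariance: the image of `P` is equivalent to `P`
    P.map (GammaProcess.multiplicator a) ≪ P ∧
    P ≪ P.map (GammaProcess.multiplicator a) ∧
    -- the density, whose exponent is an absolutely convergent integral
    (∀ᵐ η : GammaProcess.DiscreteCone X ∂P, Integrable (fun x => 1 / (a x : ℝ) - 1) (η : Measure X)) ∧
    (P.map (GammaProcess.multiplicator a)).rnDeriv P =ᵐ[P]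
      fun η => ENNReal.ofReal (GammaProcess.multiplicatorDensity ν a η) := by
  open GammaProcess in
  have := hP.isProbabilityMeasure
  obtain ⟨a', ha'm, ha'0, haa'⟩ : ∃ a' : X → ℝ≥0, Measurable a' ∧ (∀ x, 0 < a' x) ∧ a =ᵐ[ν] a' := by
    let m := ha.aemeasurable.mk a
    have hm : Measurable m := ha.aemeasurable.measurable_mk
    classical
    refine ⟨fun x => if m x = 0 then 1 else m x, ?_, fun x => ?_, ?_⟩
    · exact Measurable.ite (hm (measurableSet_singleton 0)) measurable_const hm
    · by_cases hx : m x = 0 <;> simp [hx, pos_iff_ne_zero]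
    · filter_upwards [ha.aemeasurable.ae_eq_mk, ha.ae_pos] with x hx hx0
      rw [hx] at hx0
      rw [hx, if_neg hx0.ne']
  have ha' : HasSummableLog ν a' := by
    refine ⟨ha'm.aemeasurable, ae_of_all _ ha'0, ha.integrable_log.congr ?_⟩
    filter_upwards [haa'] with x hx
    rw [hx]
  -- Almost every `η` ignores the `ν`-null set where `a` and `a'` differ, so multiplicator and
  -- density change only on a `P`-null set.
  have hη : ∀ᵐ η : DiscreteCone X ∂P, a =ᵐ[(η : Measure X)] a' := hP.ae_ae haa'
  have hfin := ha'.ae_lintegral_lt_top hP ha'm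
  have hint := ha'.ae_integrable hP ha'm
  have hmult : (multiplicator a : DiscreteCone X → _) =ᵐ[P] multiplicator a' := by
    filter_upwards [hη, hfin] with η hη hfin
    have hcoe : (fun x => (a x : ℝ≥0∞)) =ᵐ[(η : Measure X)] fun x => (a' x : ℝ≥0∞) := by
      filter_upwards [hη] with x hx
      rw [hx]
    refine Subtype.ext ?_
    rw [coe_multiplicator hfin.ne, coe_multiplicator (by rw [lintegral_congr_ae hcoe]; exact hfin.ne),
      withDensity_congr_ae hcoe]
  have hdens : (fun η => multiplicatorDensity ν a η) =ᵐ[P] fun η => multiplicatorDensity ν a' η := by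
    filter_upwards [hη] with η hη
    rw [multiplicatorDensity, multiplicatorDensity]
    congr 3
    · refine integral_congr_ae ?_
      filter_upwards [haa'] with x hx
      rw [hx]
    · refine integral_congr_ae ?_
      filter_upwards [hη] with x hx
      rw [hx]
  have hmap := hP.hasMultiplicatorDensity ha' ha'm ha'0
  rw [HasMultiplicatorDensity, ← Measure.map_congr hmult] at hmap
  have hD : AEMeasurable (fun η => ENNReal.ofReal (multiplicatorDensity ν a' η)) P :=
    ((aemeasurable_integral (by fun_prop) hint).neg.exp.const_mul _).ennreal_ofReal
  refine ⟨?_, (measurable_multiplicator ha'm).aemeasurable.congr hmult.symm, ?_, ?_, ?_, ?_⟩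
  · filter_upwards [hη, hfin] with η hη hfin
    refine lt_of_eq_of_lt (lintegral_congr_ae ?_) hfin
    filter_upwards [hη] with x hx
    rw [hx]
  · rw [hmap]
    exact withDensity_absolutelyContinuous _ _
  · rw [hmap]
    -- The reverse absolute continuity holds because the density, a product of exponentials,
    -- vanishes nowhere.
    refine withDensity_absolutelyContinuous' hD (ae_of_all _ fun η => ?_)
    rw [ENNReal.ofReal_ne_zero_iff, multiplicatorDensity]
    positivity
  · filter_upwards [hη, hint] with η hη hint
    refine hint.congr ?_
    filter_upwards [hη] with x hx
    rw [hx]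
  · rw [hmap]
    refine (Measure.rnDeriv_withDensity₀ P hD).trans ?_
    filter_upwards [hdens] with η h
    rw [h]
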